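/- Let $(\Omega,\Sigma,\mathbb P)$ be a probability space and let $L_0(\Sigma)$ be the vector lattice of real-valued $\Sigma$-measurable functions modulo $\mathbb P$-a.e. equality, ordered by $x\le y$ iff $x(\omega)\le y(\omega)$ for a.e. $\omega$. Let $X\subseteq L_0(\Sigma)$ be an ideal, i.e., a linear subspace such that $|x|\le|y|$, $x\in L_0(\Sigma)$, $y\in X$ imply $x\in X$, and suppose that $X$ contains the constant functions. A net $(x_\alpha)$ in $X$ order converges to $0$ if there is a net $(y_\alpha)$ in $X$ with the same index set that is decreasing, has infimum $0$ in $X$, and satisfies $|x_\alpha|\le y_\alpha$ for all $\alpha$. Let $X_n^\sim$ be the space of all order continuous linear functionals on $X$, i.e., of all linear $\phi:X\to\mathbb R$ such that $\phi(x_\alpha)\to0$ for every net $(x_\alpha)$ in $X$ that order converges to $0$. Suppose that there is a strictly positive $\phi\in X_n^\sim$, i.e., one with $\phi(x)>0$ for all $x\in X$ with $x\ge0$, $x\ne0$. Let $\sigma(X,X_n^\sim)$ be the coarsest topology on $X$ that makes every $\phi\in X_n^\sim$ continuous. Let $f\in X$ with $f\ge0$, let $$O_f=\operatorname{span}\{\mathbb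 1,\ (f-k\mathbb 1)^+ : k\in\mathbb R\}\subseteq X,$$ and let $\sigma(f)$ be the smallest sub-$\sigma$-algebra of $\Sigma$ that makes $f$ measurable and contains all $N\in\Sigma$ with $\mathbb P(N)=0$. Then for every $g\in X$ the following are equivalent: (a) $g$ is $\sigma(f)$-measurable; (b) $g$ belongs to the closure of $O_f$ in $X$ with respect to the topology $\sigma(X,X_n^\sim)$; (c) there is a sequence $(g_n)$ in $O_f$ such that $g_n\to g$ a.e. -/

import Mathlib

open MeasureTheory Filter Topology

/-- `L₀(Σ)`: real-valued measurable functions modulo `P`-a.e. equality, with its a.e. order. -/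
abbrev L0 {Ω : Type*} [MeasurableSpace Ω] (P : Measure Ω) : Type _ := Ω →ₘ[P] ℝ

namespace OptionSpan

universe u

variable {Ω : Type u} [mΩ : MeasurableSpace Ω] {P : Measure Ω}

/-- An ideal (solid subspace) of `L₀(Σ)`: a linear subspace `X` such that `|x| ≤ |y|` and `y ∈ X`
imply `x ∈ X`. -/
def IsIdeal (X : Submodule ℝ (L0 P)) : Prop :=
  LatticeOrderedAddCommGroup.IsSolid (X : Set (L0 P))

/-- Order convergence of a net `x` in `X` to `a`: there is a net `y` in `X` on the same index set
with `y ↓ 0` in `X` and `|x i - a| ≤ y i` for all `i`. (If `X` is an ideal, the absolute value of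
`L₀(Σ)` restricts to that of the vector lattice `X`; the infimum is taken in `X`.) -/
def OrderConverges (X : Submodule ℝ (L0 P)) {ι : Type*} [Preorder ι] (x : ι → X) (a : X) : Prop :=
  ∃ y : ι → X, Antitone y ∧ IsGLB (Set.range y) 0 ∧ ∀ i, |((x i - a : X) : L0 P)| ≤ (y i : L0 P)

/-- A linear functional on `X` is order continuous if `φ (x i) → 0` for every net `x` in `X` that
order converges to `0`. (Index sets in the universe of `X` suffice: if a net dominated by `y ↓ 0`
violates the condition, so does a net indexed by a set of pairs of elements of `X`.) -/
def IsOrderContinuous (X : Submodule ℝ (L0 P)) (φ : X →ₗ[ℝ] ℝ) : Prop :=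
  ∀ (ι : Type u) [Preorder ι] [IsDirectedOrder ι] [Nonempty ι] (x : ι → X),
    OrderConverges X x 0 → Tendsto (fun i => φ (x i)) atTop (𝓝 0)

/-- The order continuous dual `X_n^~`: all order continuous linear functionals on `X`. -/
def orderContinuousDual (X : Submodule ℝ (L0 P)) : Submodule ℝ (X →ₗ[ℝ] ℝ) where
  carrier := {φ | IsOrderContinuous X φ}
  zero_mem' := by
    intro ι _ _ _ x _
    simp
  add_mem' := by
    intro φ ψ hφ hψ ι _ _ _ x hx
    simpa using (hφ ι x hx).add (hψ ι x hx)
  smul_mem' := by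
    intro c φ hφ ι _ _ _ x hx
    simpa using (hφ ι x hx).const_mul c

/-- A linear functional on `X` is strictly positive if `φ x > 0` whenever `x > 0`, that is,
whenever `x ≥ 0` and `x ≠ 0` in `X`. -/
def IsStrictlyPositive (X : Submodule ℝ (L0 P)) (φ : X →ₗ[ℝ] ℝ) : Prop :=
  ∀ x : X, 0 < x → 0 < φ x

/-- The topology `σ(X, X_n^~)`: the weak topology on `X` of the evaluation pairing of `X` with
its order continuous dual. -/
abbrev sigmaTopology (X : Submodule ℝ (L0 P)) : TopologicalSpace X :=
  inferInstanceAs (TopologicalSpace (WeakBilin (orderContinuousDual X).subtype.flip))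

/-- The option space `O_f = span {1, (f - k)⁺ : k ∈ ℝ}`. -/
noncomputable def optionSpace (f : L0 P) : Submodule ℝ (L0 P) :=
  Submodule.span ℝ (insert 1 (Set.range fun k : ℝ => (f - AEEqFun.const Ω k)⁺))

/-- `σ(f)`: the smallest sub-σ-algebra of `Σ` that contains all `P`-null sets of `Σ` and makes `f`
measurable. (As the null sets are included, the choice of a `Σ`-measurable representative of the
class `f` is immaterial.) -/
abbrev sigmaAlgebraOf (f : L0 P) : MeasurableSpace Ω :=
  sInf {m | m ≤ mΩ ∧ (∀ N : Set Ω, MeasurableSet[mΩ] N → P N = 0 → MeasurableSet[m] N) ∧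
    Measurable[m] (f : Ω → ℝ)}

end OptionSpan

namespace OptionSpan

universe u

variable {Ω : Type u} [mΩ : MeasurableSpace Ω] {P : Measure Ω}

/-! (a) ⇒ (b): order continuous functionals obey dominated convergence (`tendsto_of_dominated`), so
the weak closure of `O_f` is a subspace closed under dominated a.e. limits of sequences. Difference
quotients of `k ↦ (f - k)⁺` converge boundedly to the indicator of `{f > k}`. A π-λ argument then
yields the indicators of all `{f ∈ B}`, and dominated approximation by simple functions yields every
`σ(f)`-measurable `g ∈ X`.

(b) ⇒ (c): a strictly positive `φ` gives the seminorm `φ |x|`, and every functional bounded by it is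
order continuous. By Hahn–Banach, a point of the weak closure therefore has distance zero from `O_f`
in this seminorm. Choosing `u n` in `O_f` with `φ |g - u n| < 2⁻ⁿ`, a Borel–Cantelli argument
(`ae_tendsto_zero_of_le_geometric`) gives a.e. convergence.

(c) ⇒ (a): `σ(f)` contains the null sets of `Σ`, so measurability survives a.e. limits. -/

theorem IsIdeal.mem_of_ae_abs_le {X : Submodule ℝ (L0 P)} (hX : IsIdeal X) {x y : L0 P} (hy : y ∈ X)
    (h : ∀ᵐ ω ∂P, |x ω| ≤ |y ω|) : x ∈ X := by
  refine hX hy ?_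
  rw [← AEEqFun.coeFn_le]
  filter_upwards [h, AEEqFun.coeFn_abs x, AEEqFun.coeFn_abs y] with ω h h1 h2
  rwa [h1, h2]

theorem IsIdeal.abs_mem {X : Submodule ℝ (L0 P)} (hX : IsIdeal X) {x : L0 P} (hx : x ∈ X) :
    |x| ∈ X := by
  refine hX.mem_of_ae_abs_le hx ?_
  filter_upwards [AEEqFun.coeFn_abs x] with ω h
  rw [h, abs_abs]

/-! ### Dominated a.e. convergence and order convergence -/

theorem ae_antitone_of_forall {u : ℕ → L0 P} (h : ∀ n, ∀ᵐ ω ∂P, u (n + 1) ω ≤ u n ω) :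
    Antitone u :=
  antitone_nat_of_succ_le fun n => AEEqFun.coeFn_le.1 (h n)

/-- A sequence in an ideal that converges almost everywhere and is dominated in the ideal is
order convergent. -/
theorem orderConverges_of_dominated {X : Submodule ℝ (L0 P)} (hX : IsIdeal X)
    {x : ℕ → X} {y : X} (hxy : ∀ n, ∀ᵐ ω ∂P, |(x n : L0 P) ω| ≤ (y : L0 P) ω)
    (hx : ∀ᵐ ω ∂P, Tendsto (fun n => (x n : L0 P) ω) atTop (𝓝 0)) :
    OrderConverges X (fun n : ULift.{u} ℕ => x n.down) 0 := by
  -- The dominating net consists of the tail suprema of `|x n|`: they lie below `y`, hence in `X`,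
  -- and decrease to `0` wherever `x` does. The default value of a real `⨆` over an unbounded family
  -- occurs only on a null set.
  have hm : ∀ n, Measurable fun ω => ⨆ k, |(x (n + k) : L0 P) ω| := fun n =>
    Measurable.iSup fun k => ((x (n + k) : L0 P).measurable).abs
  let s : ℕ → L0 P := fun n => AEEqFun.mk _ (hm n).aestronglyMeasurable
  have hs : ∀ n, ∀ᵐ ω ∂P, s n ω = ⨆ k, |(x (n + k) : L0 P) ω| := fun n =>
    AEEqFun.coeFn_mk _ (hm n).aestronglyMeasurable
  have hxy' := ae_all_iff.2 hxy
  have hsX : ∀ n, s n ∈ X := fun n => by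
    refine hX.mem_of_ae_abs_le y.2 ?_
    filter_upwards [hs n, hxy'] with ω h1 h2
    rw [h1, abs_of_nonneg (Real.iSup_nonneg fun _ => abs_nonneg _)]
    exact (ciSup_le fun k => h2 _).trans (le_abs_self _)
  have hsle : ∀ n, ∀ᵐ ω ∂P, |(x n : L0 P) ω| ≤ s n ω := fun n => by
    filter_upwards [hs n, hxy'] with ω h1 h2
    rw [h1]
    exact le_ciSup (f := fun k => |(x (n + k) : L0 P) ω|)
      ⟨(y : L0 P) ω, by rintro _ ⟨k, rfl⟩; exact h2 _⟩ 0
  have hanti : Antitone s := ae_antitone_of_forall fun n => by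
    filter_upwards [hs n, hs (n + 1), hxy'] with ω h1 h2 h3
    rw [h1, h2]
    refine ciSup_le fun k => ?_
    have := le_ciSup (f := fun k => |(x (n + k) : L0 P) ω|)
      ⟨(y : L0 P) ω, by rintro _ ⟨k, rfl⟩; exact h3 _⟩ (1 + k)
    simpa only [add_assoc] using this
  have hslim : ∀ᵐ ω ∂P, Tendsto (fun n => s n ω) atTop (𝓝 0) := by
    filter_upwards [ae_all_iff.2 hs, hx] with ω h1 h2
    rw [Metric.tendsto_atTop] at h2 ⊢
    intro ε hε
    obtain ⟨N, hN⟩ := h2 (ε / 2) (half_pos hε)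
    refine ⟨N, fun n hn => ?_⟩
    rw [h1, Real.dist_eq, sub_zero, abs_of_nonneg (Real.iSup_nonneg fun _ => abs_nonneg _)]
    refine (ciSup_le fun k => ?_).trans_lt (half_lt_self hε)
    simpa [Real.dist_eq] using (hN (n + k) (by omega)).le
  refine ⟨fun n => ⟨s n.down, hsX _⟩, fun a b hab => hanti hab, ⟨?_, fun z hz => ?_⟩, fun n => ?_⟩
  · rintro _ ⟨n, rfl⟩
    change (0 : L0 P) ≤ s n.down
    rw [← AEEqFun.coeFn_le]
    filter_upwards [hsle n.down, AEEqFun.coeFn_zero (α := Ω) (β := ℝ) (μ := P)] with ω h1 h2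
    rw [h2]
    exact (abs_nonneg _).trans h1
  · change (z : L0 P) ≤ 0
    have hz' : ∀ n, (z : L0 P) ≤ s n := fun n => hz ⟨ULift.up n, rfl⟩
    simp only [← AEEqFun.coeFn_le] at hz' ⊢
    filter_upwards [ae_all_iff.2 hz', hslim, AEEqFun.coeFn_zero (α := Ω) (β := ℝ) (μ := P)]
      with ω h1 h2 h3
    rw [h3]
    exact ge_of_tendsto' h2 h1
  · rw [sub_zero]
    change _ ≤ s n.down
    rw [← AEEqFun.coeFn_le]
    filter_upwards [hsle n.down, AEEqFun.coeFn_abs (x n.down : L0 P)] with ω h1 h2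
    rwa [h2]

/-- Dominated convergence for order continuous functionals. -/
theorem tendsto_of_dominated {X : Submodule ℝ (L0 P)} (hX : IsIdeal X) {φ : X →ₗ[ℝ] ℝ}
    (hφ : φ ∈ orderContinuousDual X) {x : ℕ → X} {a y : X}
    (hxy : ∀ n, ∀ᵐ ω ∂P, |(x n : L0 P) ω| ≤ (y : L0 P) ω)
    (hx : ∀ᵐ ω ∂P, Tendsto (fun n => (x n : L0 P) ω) atTop (𝓝 ((a : L0 P) ω))) :
    Tendsto (fun n => φ (x n)) atTop (𝓝 (φ a)) := by
  have hsub : ∀ n, ∀ᵐ ω ∂P,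
      ((x n - a : X) : L0 P) ω = (x n : L0 P) ω - (a : L0 P) ω := fun n =>
    AEEqFun.coeFn_sub _ _
  have key := orderConverges_of_dominated hX (x := fun n => x n - a)
    (y := y + ⟨|(a : L0 P)|, hX.abs_mem a.2⟩) (fun n => by
      filter_upwards [hsub n, hxy n, AEEqFun.coeFn_add (y : L0 P) |(a : L0 P)|,
        AEEqFun.coeFn_abs (a : L0 P)] with ω h1 h2 h3 h4
      rw [h1]
      refine (abs_sub _ _).trans ?_
      change _ ≤ ((y : L0 P) + |(a : L0 P)|) ω
      rw [h3, Pi.add_apply, h4]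
      gcongr) (by
      filter_upwards [ae_all_iff.2 hsub, hx] with ω h1 h2
      simp only [h1]
      simpa using h2.sub_const ((a : L0 P) ω))
  -- Order continuity is tested on index types in universe `u`, hence `ULift ℕ`; composing with
  -- `ULift.up` returns to sequences.
  have h := (hφ (ULift.{u} ℕ) _ key).comp
    (tendsto_atTop_mono (f := fun n : ℕ => (ULift.up.{u} n)) (fun n => le_rfl)
      (tendsto_atTop_atTop.2 fun b => ⟨b.down, fun n hn => hn⟩))
  have h' : Tendsto (fun n => φ (x n) - φ a) atTop (𝓝 0) := by
    simpa [Function.comp_def] using h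
  simpa using h'.add_const (φ a)

/-! ### Strictly positive functionals and Borel–Cantelli -/

theorem IsStrictlyPositive.monotone {X : Submodule ℝ (L0 P)} {φ : X →ₗ[ℝ] ℝ}
    (hφ : IsStrictlyPositive X φ) {a b : X} (hab : ∀ᵐ ω ∂P, (a : L0 P) ω ≤ (b : L0 P) ω) :
    φ a ≤ φ b := by
  have hab' : a ≤ b := AEEqFun.coeFn_le.1 hab
  rcases hab'.eq_or_lt with rfl | h
  · rfl
  have h2 : 0 < b - a := by
    refine lt_of_le_of_ne ?_ fun h0 => h.ne (sub_eq_zero.1 h0.symm).symm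
    change (0 : L0 P) ≤ ((b - a : X) : L0 P)
    rw [← AEEqFun.coeFn_le]
    filter_upwards [hab, AEEqFun.coeFn_sub (b : L0 P) (a : L0 P),
      AEEqFun.coeFn_zero (α := Ω) (β := ℝ) (μ := P)] with ω h1 h2 h3
    change (0 : L0 P) ω ≤ ((b : L0 P) - (a : L0 P)) ω
    rw [h2, h3]
    simpa using h1
  have := hφ _ h2
  rw [map_sub] at this
  linarith

theorem coe_sum_ae {X : Submodule ℝ (L0 P)} (z : ℕ → X) (s : Finset ℕ) :
    ∀ᵐ ω ∂P, ((∑ k ∈ s, z k : X) : L0 P) ω = ∑ k ∈ s, (z k : L0 P) ω := by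
  classical
  induction s using Finset.induction_on with
  | empty =>
    filter_upwards [AEEqFun.coeFn_zero (α := Ω) (β := ℝ) (μ := P)] with ω h
    simpa using h
  | insert a s ha ih =>
    rw [Finset.sum_insert ha]
    filter_upwards [ih, AEEqFun.coeFn_add (z a : L0 P) ((∑ k ∈ s, z k : X) : L0 P)] with ω h1 h2
    rw [Finset.sum_insert ha, ← h1]
    exact h2

/-- A Borel–Cantelli type statement for strictly positive order continuous functionals. -/
theorem ae_tendsto_zero_of_le_geometric {X : Submodule ℝ (L0 P)} (hX : IsIdeal X)
    (hconst : ∀ c : ℝ, AEEqFun.const Ω c ∈ X) {φ : X →ₗ[ℝ] ℝ} (hφ : φ ∈ orderContinuousDual X)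
    (hpos : IsStrictlyPositive X φ) {z : ℕ → X} (hz : ∀ n, ∀ᵐ ω ∂P, 0 ≤ (z n : L0 P) ω)
    (hφz : ∀ n, φ (z n) ≤ (1 / 2 : ℝ) ^ n) :
    ∀ᵐ ω ∂P, Tendsto (fun n => (z n : L0 P) ω) atTop (𝓝 0) := by
  -- The tail sums of `z` may be infinite or leave `X`; truncation at `1` keeps them in `X`. With `S
  -- n` the truncated tail sum, dominated convergence gives `φ (S n) ≤ 2 * 2⁻ⁿ`, so `T = ⨅ n, S n`
  -- has `φ T ≤ 0` and vanishes a.e. by strict positivity.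
  let v : ℕ → ℕ → Ω → ℝ := fun n m ω => min 1 (∑ k ∈ Finset.range m, (z (n + k) : L0 P) ω)
  have hvm : ∀ n m, Measurable (v n m) := fun n m =>
    measurable_const.min (Finset.measurable_fun_sum _ fun k _ => (z (n + k) : L0 P).measurable)
  have hz' := ae_all_iff.2 hz
  have hv0 : ∀ᵐ ω ∂P, ∀ n m, 0 ≤ v n m ω := by
    filter_upwards [hz'] with ω h n m
    exact le_min zero_le_one (Finset.sum_nonneg fun k _ => h _)
  have hv1 : ∀ n m ω, v n m ω ≤ 1 := fun n m ω => min_le_left _ _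
  let S : ℕ → Ω → ℝ := fun n ω => ⨆ m, v n m ω
  have hSm : ∀ n, Measurable (S n) := fun n => Measurable.iSup (hvm n)
  have hbdd : ∀ n ω, BddAbove (Set.range fun m => v n m ω) := fun n ω =>
    ⟨1, by rintro _ ⟨m, rfl⟩; exact hv1 _ _ _⟩
  have hS1 : ∀ n ω, S n ω ≤ 1 := fun n ω => ciSup_le fun m => hv1 n m ω
  have hvS : ∀ n m ω, v n m ω ≤ S n ω := fun n m ω => le_ciSup (hbdd n ω) m
  have hS0 : ∀ᵐ ω ∂P, ∀ n, 0 ≤ S n ω := by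
    filter_upwards [hv0] with ω h n
    exact (h n 0).trans (hvS n 0 ω)
  let T : Ω → ℝ := fun ω => ⨅ n, S n ω
  have hTm : Measurable T := Measurable.iInf hSm
  have hT0 : ∀ᵐ ω ∂P, 0 ≤ T ω := by
    filter_upwards [hS0] with ω h
    exact Real.iInf_nonneg h
  have hTS : ∀ᵐ ω ∂P, ∀ n, T ω ≤ S n ω := by
    filter_upwards [hS0] with ω h n
    exact ciInf_le ⟨0, by rintro _ ⟨m, rfl⟩; exact h m⟩ n
  have hmem : ∀ {w : Ω → ℝ} (hw : Measurable w), (∀ᵐ ω ∂P, 0 ≤ w ω) → (∀ᵐ ω ∂P, w ω ≤ 1) →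
      AEEqFun.mk w hw.aestronglyMeasurable ∈ X := fun {w} hw h0 h1 => by
    refine hX.mem_of_ae_abs_le (hconst 1) ?_
    filter_upwards [h0, h1, AEEqFun.coeFn_mk w (hw.aestronglyMeasurable (μ := P)),
      AEEqFun.coeFn_const Ω (μ := P) (1 : ℝ)] with ω h0 h1 h2 h3
    rw [h2, h3, abs_of_nonneg h0]
    simpa using h1
  let vX : ℕ → ℕ → X := fun n m => ⟨_, hmem (hvm n m) (hv0.mono fun ω h => h n m)
    (.of_forall (hv1 n m))⟩
  let SX : ℕ → X := fun n => ⟨_, hmem (hSm n) (hS0.mono fun ω h => h n) (.of_forall (hS1 n))⟩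
  let TX : X := ⟨_, hmem hTm hT0 (by
    filter_upwards [hTS] with ω h using (h 0).trans (hS1 0 ω))⟩
  have hvX : ∀ n m, ∀ᵐ ω ∂P, (vX n m : L0 P) ω = v n m ω := fun n m => AEEqFun.coeFn_mk _ _
  have hSX : ∀ n, ∀ᵐ ω ∂P, (SX n : L0 P) ω = S n ω := fun n => AEEqFun.coeFn_mk _ _
  have hTX : ∀ᵐ ω ∂P, (TX : L0 P) ω = T ω := AEEqFun.coeFn_mk _ _
  have hφv : ∀ n m, φ (vX n m) ≤ (1 / 2 : ℝ) ^ n * 2 := fun n m => by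
    calc φ (vX n m) ≤ φ (∑ k ∈ Finset.range m, z (n + k)) := hpos.monotone (by
          filter_upwards [hvX n m, coe_sum_ae (fun k => z (n + k)) (Finset.range m)] with ω h1 h2
          rw [h1, h2]
          exact min_le_right _ _)
      _ = ∑ k ∈ Finset.range m, φ (z (n + k)) := map_sum _ _ _
      _ ≤ ∑ k ∈ Finset.range m, (1 / 2 : ℝ) ^ n * (1 / 2 : ℝ) ^ k :=
          Finset.sum_le_sum fun k _ => (hφz _).trans_eq (pow_add _ _ _)
      _ ≤ (1 / 2 : ℝ) ^ n * 2 := by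
          rw [← Finset.mul_sum]
          gcongr
          exact sum_geometric_two_le m
  have hφS : ∀ n, φ (SX n) ≤ (1 / 2 : ℝ) ^ n * 2 := fun n => by
    refine le_of_tendsto' (tendsto_of_dominated hX hφ (x := vX n) (a := SX n)
      (y := ⟨_, hconst 1⟩) (fun m => ?_) ?_) (hφv n)
    · filter_upwards [hvX n m, hv0, AEEqFun.coeFn_const Ω (μ := P) (1 : ℝ)] with ω h1 h2 h3
      rw [h1, h3, abs_of_nonneg (h2 n m)]
      exact hv1 n m ω
    · filter_upwards [ae_all_iff.2 (hvX n), hSX n, hz'] with ω h1 h2 h3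
      simp only [h1, h2]
      refine tendsto_atTop_ciSup (monotone_nat_of_le_succ fun m => ?_) (hbdd n ω)
      refine min_le_min le_rfl ?_
      rw [Finset.sum_range_succ]
      exact le_add_of_nonneg_right (h3 _)
  have hφT : φ TX ≤ 0 := by
    have hlim : Tendsto (fun n : ℕ => (1 / 2 : ℝ) ^ n * 2) atTop (𝓝 0) := by
      simpa using (tendsto_pow_atTop_nhds_zero_of_lt_one (r := (1 / 2 : ℝ))
        (by norm_num) (by norm_num)).mul_const 2
    refine ge_of_tendsto' hlim fun n => (hpos.monotone ?_).trans (hφS n)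
    filter_upwards [hTX, hSX n, hTS] with ω h1 h2 h3
    rw [h1, h2]
    exact h3 n
  have hTX0 : (0 : X) ≤ TX := by
    change (0 : L0 P) ≤ (TX : L0 P)
    rw [← AEEqFun.coeFn_le]
    filter_upwards [hTX, hT0, AEEqFun.coeFn_zero (α := Ω) (β := ℝ) (μ := P)] with ω h1 h2 h3
    rw [h1, h3]
    exact h2
  have hTeq : TX = 0 := by
    by_contra h
    exact absurd (hpos TX (lt_of_le_of_ne hTX0 (Ne.symm h))) hφT.not_gt
  have hTae : ∀ᵐ ω ∂P, T ω = 0 := by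
    rw [hTeq] at hTX
    filter_upwards [hTX, AEEqFun.coeFn_zero (α := Ω) (β := ℝ) (μ := P)] with ω h1 h2
    rw [← h1]
    exact h2
  filter_upwards [hTae, hz'] with ω h1 h2
  rw [Metric.tendsto_atTop]
  intro ε hε
  -- A tail sum below `1` is unaffected by the truncation, whence `min ε 1` instead of `ε`.
  obtain ⟨n, hn⟩ := exists_lt_of_ciInf_lt (f := fun n => S n ω) (a := min ε 1)
    (lt_of_eq_of_lt h1 (lt_min hε one_pos))
  refine ⟨n, fun k hk => ?_⟩
  obtain ⟨j, rfl⟩ := Nat.exists_eq_add_of_le hk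
  have h3 : min 1 ((z (n + j) : L0 P) ω) ≤ S n ω := by
    refine le_trans (min_le_min le_rfl ?_) (hvS n (j + 1) ω)
    exact Finset.single_le_sum (f := fun k => (z (n + k) : L0 P) ω) (fun k _ => h2 _)
      (Finset.self_mem_range_succ j)
  rw [Real.dist_eq, sub_zero, abs_of_nonneg (h2 _)]
  have h4 := h3.trans_lt hn
  rcases le_total 1 ((z (n + j) : L0 P) ω) with h | h
  · rw [min_eq_left h] at h4
    exact absurd h4 (min_le_right _ _).not_gt
  · rw [min_eq_right h] at h4
    exact h4.trans_le (min_le_left _ _)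

/-! ### Hahn–Banach separation and the seminorm `φ |x|` -/

/-- A consequence of the Hahn–Banach theorem: a point at positive distance from a subspace, with
respect to a seminorm, is separated from it by a dominated linear functional. -/
theorem _root_.Seminorm.exists_dual_forall_mem_eq_zero {E : Type*} [AddCommGroup E] [Module ℝ E]
    (p : Seminorm ℝ E) (S : Submodule ℝ E) {g : E} {d : ℝ} (hd : 0 < d)
    (h : ∀ u ∈ S, d ≤ p (g - u)) :
    ∃ ψ : E →ₗ[ℝ] ℝ, (∀ u ∈ S, ψ u = 0) ∧ ψ g = d ∧ ∀ x, |ψ x| ≤ p x := by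
  have hg : g ∉ S := fun hg => by
    have := h g hg
    simp only [sub_self, map_zero] at this
    linarith
  let F : E →ₗ.[ℝ] ℝ := LinearPMap.supSpanSingleton ⟨S, 0⟩ g d hg
  have hF : ∀ x : F.domain, F x ≤ p x := by
    rintro ⟨x, hx⟩
    obtain ⟨u, hu, w, hw, rfl⟩ := Submodule.mem_sup.1 hx
    obtain ⟨c, rfl⟩ := Submodule.mem_span_singleton.1 hw
    have e := LinearPMap.supSpanSingleton_apply_mk (⟨S, 0⟩ : E →ₗ.[ℝ] ℝ) g d hg u hu c
    refine e.trans_le ?_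
    simp only [LinearMap.zero_apply, zero_add, RingHom.id_apply, smul_eq_mul, LinearPMap.mk_apply]
    rcases eq_or_ne c 0 with rfl | hc
    · simp
    calc c * d ≤ |c| * d := by gcongr; exact le_abs_self c
      _ ≤ |c| * p (g - (-c⁻¹) • u) := by gcongr; exact h _ (S.smul_mem _ hu)
      _ = p (c • (g - (-c⁻¹) • u)) := by rw [map_smul_eq_mul, Real.norm_eq_abs]
      _ = p (u + c • g) := by
        congr 1
        rw [smul_sub, smul_smul, mul_neg, mul_inv_cancel₀ hc, neg_one_smul, sub_neg_eq_add,
          add_comm]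
  obtain ⟨ψ, hψ, hψp⟩ := Module.Dual.exists_extension_of_le_seminorm_real F.domain F.toFun hF
  refine ⟨ψ, fun u hu => ?_, ?_, hψp⟩
  · have := hψ ⟨u, Submodule.mem_sup_left hu⟩
    rw [this]
    exact (LinearPMap.supSpanSingleton_apply_mk_of_mem (⟨S, 0⟩ : E →ₗ.[ℝ] ℝ) d hg hu)
  · have := hψ ⟨g, Submodule.mem_sup_right (Submodule.mem_span_singleton_self _)⟩
    rw [this]
    exact LinearPMap.supSpanSingleton_apply_self (⟨S, 0⟩ : E →ₗ.[ℝ] ℝ) d hg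

/-- The seminorm `x ↦ φ |x|` of a strictly positive functional `φ`. -/
noncomputable def absSeminorm {X : Submodule ℝ (L0 P)} (hX : IsIdeal X) (φ : X →ₗ[ℝ] ℝ)
    (hpos : IsStrictlyPositive X φ) : Seminorm ℝ X :=
  Seminorm.of (fun x => φ ⟨|(x : L0 P)|, hX.abs_mem x.2⟩)
    (fun x y => by
      rw [← map_add]
      refine hpos.monotone ?_
      filter_upwards [AEEqFun.coeFn_abs ((x : L0 P) + (y : L0 P)),
        AEEqFun.coeFn_add (x : L0 P) (y : L0 P),
        AEEqFun.coeFn_abs (x : L0 P), AEEqFun.coeFn_abs (y : L0 P),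
        AEEqFun.coeFn_add |(x : L0 P)| |(y : L0 P)|] with ω h1 h2 h3 h4 h5
      change |(x : L0 P) + (y : L0 P)| ω ≤ (|(x : L0 P)| + |(y : L0 P)|) ω
      rw [h1, h2, h5, Pi.add_apply, Pi.add_apply, h3, h4]
      exact abs_add_le _ _)
    (fun c x => by
      rw [Real.norm_eq_abs, ← smul_eq_mul, ← map_smul]
      congr 1
      ext1
      refine AEEqFun.ext ?_
      filter_upwards [AEEqFun.coeFn_abs (c • (x : L0 P)), AEEqFun.coeFn_smul c (x : L0 P),
        AEEqFun.coeFn_abs (x : L0 P), AEEqFun.coeFn_smul |c| |(x : L0 P)|] with ω h1 h2 h3 h4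
      change |c • (x : L0 P)| ω = (|c| • |(x : L0 P)|) ω
      rw [h1, h2, h4, Pi.smul_apply, Pi.smul_apply, h3, smul_eq_mul, smul_eq_mul, abs_mul])

/-- If `|x i| ≤ y i` with `y ↓ 0`, then `|ψ (x i)| ≤ φ |x i| ≤ φ (y i)`, and the last term tends to
`0` because `y` itself order converges to `0`. -/
theorem mem_orderContinuousDual_of_abs_le {X : Submodule ℝ (L0 P)} (hX : IsIdeal X)
    {φ ψ : X →ₗ[ℝ] ℝ} (hφ : φ ∈ orderContinuousDual X) (hpos : IsStrictlyPositive X φ)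
    (h : ∀ x, |ψ x| ≤ absSeminorm hX φ hpos x) : ψ ∈ orderContinuousDual X := by
  rintro ι _ _ _ x ⟨y, hy, hglb, hxy⟩
  have hy0 : ∀ i, (0 : L0 P) ≤ (y i : L0 P) := fun i => hglb.1 ⟨i, rfl⟩
  have hlim : Tendsto (fun i => φ (y i)) atTop (𝓝 0) := hφ ι y ⟨y, hy, hglb, fun i => by
    rw [sub_zero, ← AEEqFun.coeFn_le]
    have := AEEqFun.coeFn_le.2 (hy0 i)
    filter_upwards [AEEqFun.coeFn_abs (y i : L0 P), this,
      AEEqFun.coeFn_zero (α := Ω) (β := ℝ) (μ := P)] with ω h1 h2 h3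
    rw [h3] at h2
    rw [h1, abs_of_nonneg h2]⟩
  refine squeeze_zero_norm (fun i => (h (x i)).trans ?_) hlim
  refine hpos.monotone ?_
  have := hxy i
  rw [sub_zero] at this
  exact AEEqFun.coeFn_le.2 this

/-- A point of the weak closure of a subspace is annihilated by every order continuous functional
that annihilates the subspace. -/
theorem eq_zero_of_mem_closure {X : Submodule ℝ (L0 P)} {S : Set X} {g : X}
    (hg : g ∈ closure[sigmaTopology X] S) {ψ : X →ₗ[ℝ] ℝ} (hψ : ψ ∈ orderContinuousDual X)
    (h : ∀ u ∈ S, ψ u = 0) : ψ g = 0 := by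
  let _ := sigmaTopology X
  have hc : Continuous fun x : X => ψ x :=
    WeakBilin.eval_continuous (orderContinuousDual X).subtype.flip ⟨ψ, hψ⟩
  exact closure_minimal (t := {x : X | ψ x = 0}) h (isClosed_eq hc continuous_const) hg

/-- If `g` had positive distance from `S` for `φ |x|`, a separating functional would be order
continuous and vanish on `S` but not at `g`, contradicting weak closure. The approximants can thus
be taken with geometric errors. -/
theorem exists_seq_ae_tendsto_of_mem_closure {X : Submodule ℝ (L0 P)} (hX : IsIdeal X)
    (hconst : ∀ c : ℝ, AEEqFun.const Ω c ∈ X) {φ : X →ₗ[ℝ] ℝ} (hφ : φ ∈ orderContinuousDual X)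
    (hpos : IsStrictlyPositive X φ) (S : Submodule ℝ X) {g : X}
    (hg : g ∈ closure[sigmaTopology X] (S : Set X)) :
    ∃ u : ℕ → X, (∀ n, u n ∈ S) ∧
      ∀ᵐ ω ∂P, Tendsto (fun n => (u n : L0 P) ω) atTop (𝓝 ((g : L0 P) ω)) := by
  have hdist : ∀ d > 0, ∃ u ∈ S, absSeminorm hX φ hpos (g - u) < d := fun d hd => by
    by_contra! hcon
    obtain ⟨ψ, h0, h1, h2⟩ :=
      (absSeminorm hX φ hpos).exists_dual_forall_mem_eq_zero S hd hcon
    have := eq_zero_of_mem_closure hg (mem_orderContinuousDual_of_abs_le hX hφ hpos h2) h0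
    linarith
  choose u huS hu using fun n : ℕ => hdist ((1 / 2 : ℝ) ^ n) (by positivity)
  refine ⟨u, huS, ?_⟩
  have habs : ∀ n, ∀ᵐ ω ∂P,
      |((g - u n : X) : L0 P)| ω = |(g : L0 P) ω - (u n : L0 P) ω| := fun n => by
    filter_upwards [AEEqFun.coeFn_abs ((g - u n : X) : L0 P),
      AEEqFun.coeFn_sub (g : L0 P) (u n : L0 P)] with ω h1 h2
    rw [h1]
    exact congrArg abs h2
  have := ae_tendsto_zero_of_le_geometric hX hconst hφ hpos
    (z := fun n => ⟨|((g - u n : X) : L0 P)|, hX.abs_mem (g - u n).2⟩) (fun n => by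
      filter_upwards [habs n] with ω h
      rw [h]
      exact abs_nonneg _) (fun n => (hu n).le)
  filter_upwards [this, ae_all_iff.2 habs] with ω h1 h2
  simp only [h2] at h1
  rw [tendsto_iff_dist_tendsto_zero]
  simpa only [dist_comm, Real.dist_eq] using h1

/-! ### The completed σ-algebra `σ(f)` -/

theorem sigmaAlgebraOf_le (f : L0 P) : sigmaAlgebraOf f ≤ mΩ :=
  sInf_le ⟨le_rfl, fun _ hN _ => hN, f.measurable⟩

theorem measurableSet_sigmaAlgebraOf_of_null (f : L0 P) {N : Set Ω} (hN : MeasurableSet N)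
    (hN0 : P N = 0) : MeasurableSet[sigmaAlgebraOf f] N :=
  MeasurableSpace.measurableSet_sInf.2 fun _ hm => hm.2.1 N hN hN0

theorem measurable_sigmaAlgebraOf_self (f : L0 P) : Measurable[sigmaAlgebraOf f] (f : Ω → ℝ) :=
  fun _ ht => MeasurableSpace.measurableSet_sInf.2 fun _ hm => hm.2.2 ht

theorem exists_measurableSet_ae_eq_preimage (f : L0 P) {A : Set Ω}
    (hA : MeasurableSet[sigmaAlgebraOf f] A) :
    ∃ B : Set ℝ, MeasurableSet B ∧ A =ᵐ[P] (f : Ω → ℝ) ⁻¹' B := by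
  have hle : sigmaAlgebraOf f ≤
      eventuallyMeasurableSpace (MeasurableSpace.comap (f : Ω → ℝ) inferInstance) (ae P) := by
    -- The sets a.e. equal to a preimage under `f` form a σ-algebra; intersecting it with `Σ` makes
    -- it a competitor in the infimum defining `σ(f)`.
    refine le_trans (sInf_le (a := eventuallyMeasurableSpace
      (MeasurableSpace.comap (f : Ω → ℝ) inferInstance) (ae P) ⊓ mΩ) ⟨inf_le_right, ?_, ?_⟩)
      inf_le_left
    · refine fun N hN hN0 => MeasurableSpace.measurableSet_inf.2 ⟨⟨∅, ?_, ?_⟩, hN⟩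
      · exact @MeasurableSet.empty _ (MeasurableSpace.comap (f : Ω → ℝ) inferInstance)
      · exact ae_eq_empty.2 hN0
    · exact fun t ht => MeasurableSpace.measurableSet_inf.2
        ⟨le_eventuallyMeasurableSpace _ ⟨t, ht, rfl⟩, f.measurable ht⟩
  obtain ⟨_, ⟨B, hB, rfl⟩, h⟩ := hle _ hA
  exact ⟨B, hB, h⟩

/-- Preimages under `h` and `k` differ by null sets. Measurability of `h` puts these null sets in
`Σ`, hence in `σ(f)`. -/
theorem measurable_sigmaAlgebraOf_congr (f : L0 P) {h k : Ω → ℝ} (hh : Measurable h)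
    (hk : Measurable[sigmaAlgebraOf f] k) (hhk : h =ᵐ[P] k) : Measurable[sigmaAlgebraOf f] h := by
  intro t ht
  have h1 : MeasurableSet (h ⁻¹' t) := hh ht
  have h2 : MeasurableSet[sigmaAlgebraOf f] (k ⁻¹' t) := hk ht
  have h2' := sigmaAlgebraOf_le f _ h2
  have hst : h ⁻¹' t =ᵐ[P] k ⁻¹' t := by
    filter_upwards [hhk] with ω hω
    change (h ω ∈ t) = (k ω ∈ t)
    rw [hω]
  have n1 := measurableSet_sigmaAlgebraOf_of_null f (h2'.diff h1) (ae_le_set.1 hst.symm.le)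
  have n2 := measurableSet_sigmaAlgebraOf_of_null f (h1.diff h2') (ae_le_set.1 hst.le)
  have e : h ⁻¹' t = (k ⁻¹' t \ (k ⁻¹' t \ h ⁻¹' t)) ∪ (h ⁻¹' t \ k ⁻¹' t) := by
    ext ω
    simp only [Set.mem_union, Set.mem_sdiff]
    tauto
  rw [e]
  exact MeasurableSet.union (MeasurableSet.diff h2 n1) n2

theorem measurable_sigmaAlgebraOf_of_tendsto (f : L0 P) {u : ℕ → Ω → ℝ} {h : Ω → ℝ}
    (hu : ∀ n, Measurable[sigmaAlgebraOf f] (u n)) (hh : Measurable h)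
    (hlim : ∀ᵐ ω ∂P, Tendsto (fun n => u n ω) atTop (𝓝 (h ω))) :
    Measurable[sigmaAlgebraOf f] h := by
  obtain ⟨N, hN, hNm, hN0⟩ := exists_measurable_superset_of_null hlim
  have hNm' := measurableSet_sigmaAlgebraOf_of_null f hNm hN0
  -- Setting everything to `0` on the null set `N` turns a.e. convergence into convergence
  -- everywhere.
  have hk : Measurable[sigmaAlgebraOf f] (Nᶜ.indicator h) := by
    refine @measurable_of_tendsto_metrizable Ω ℝ (sigmaAlgebraOf f) _ _ _ _
      (fun n => Nᶜ.indicator (u n)) _ (fun n => Measurable.indicator (hu n) hNm'.compl) ?_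
    rw [tendsto_pi_nhds]
    intro ω
    by_cases hω : ω ∈ N
    · simp [hω]
    · simpa [hω] using by_contra fun h' => hω (hN h')
  refine measurable_sigmaAlgebraOf_congr f hh hk ?_
  filter_upwards [measure_eq_zero_iff_ae_notMem.1 hN0] with ω hω
  simp [hω]

theorem coeFn_posPart_sub_const (f : L0 P) (k : ℝ) :
    ∀ᵐ ω ∂P, ((f - AEEqFun.const Ω k)⁺ : L0 P) ω = max (f ω - k) 0 := by
  filter_upwards [AEEqFun.coeFn_sup (f - AEEqFun.const Ω k) 0,
    AEEqFun.coeFn_sub f (AEEqFun.const Ω k), AEEqFun.coeFn_const Ω (μ := P) k,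
    AEEqFun.coeFn_zero (α := Ω) (β := ℝ) (μ := P)] with ω h1 h2 h3 h4
  rw [posPart_def, h1, h2, Pi.sub_apply, h3, h4, Function.const_apply, Pi.zero_apply]

theorem measurable_of_mem_optionSpace (f : L0 P) {u : L0 P} (hu : u ∈ optionSpace f) :
    Measurable[sigmaAlgebraOf f] (u : Ω → ℝ) := by
  induction hu using Submodule.span_induction with
  | mem x hx =>
    rcases hx with rfl | ⟨k, rfl⟩
    · exact measurable_sigmaAlgebraOf_congr f (AEEqFun.measurable _)
        (@measurable_const _ _ _ (sigmaAlgebraOf f) (1 : ℝ)) AEEqFun.coeFn_one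
    · refine measurable_sigmaAlgebraOf_congr f (k := fun ω => max (f ω - k) 0)
        (AEEqFun.measurable _)
        (((measurable_sigmaAlgebraOf_self f).sub_const k).max measurable_const) ?_
      exact coeFn_posPart_sub_const f k
  | zero =>
    exact measurable_sigmaAlgebraOf_congr f (AEEqFun.measurable _)
      (@measurable_const _ _ _ (sigmaAlgebraOf f) (0 : ℝ)) AEEqFun.coeFn_zero
  | add x y _ _ hx hy =>
    exact measurable_sigmaAlgebraOf_congr f (AEEqFun.measurable _) (Measurable.add hx hy)
      (AEEqFun.coeFn_add x y)
  | smul c x _ hx =>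
    exact measurable_sigmaAlgebraOf_congr f (AEEqFun.measurable _) (Measurable.const_smul hx c)
      (AEEqFun.coeFn_smul c x)

/-! ### Subspaces closed under dominated limits -/

/-- A subspace of `X` is closed under dominated almost everywhere convergence of sequences. -/
def IsDominatedClosed {X : Submodule ℝ (L0 P)} (D : Submodule ℝ X) : Prop :=
  ∀ (u : ℕ → X) (v y : X), (∀ n, u n ∈ D) → (∀ n, ∀ᵐ ω ∂P, |(u n : L0 P) ω| ≤ (y : L0 P) ω) →
    (∀ᵐ ω ∂P, Tendsto (fun n => (u n : L0 P) ω) atTop (𝓝 ((v : L0 P) ω))) → v ∈ D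

/-- The function `h` is almost everywhere equal to an element of `D`. -/
def Represents {X : Submodule ℝ (L0 P)} (D : Submodule ℝ X) (h : Ω → ℝ) : Prop :=
  ∃ x ∈ D, (x : L0 P) =ᵐ[P] h

namespace Represents

variable {X : Submodule ℝ (L0 P)} {D : Submodule ℝ X} {h k : Ω → ℝ}

theorem congr (hh : Represents D h) (hk : h =ᵐ[P] k) : Represents D k := by
  obtain ⟨x, hx, e⟩ := hh
  exact ⟨x, hx, e.trans hk⟩

theorem zero (D : Submodule ℝ X) : Represents D fun _ => 0 :=
  ⟨0, D.zero_mem, AEEqFun.coeFn_zero⟩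

theorem add (hh : Represents D h) (hk : Represents D k) : Represents D fun ω => h ω + k ω := by
  obtain ⟨x, hx, ex⟩ := hh
  obtain ⟨y, hy, ey⟩ := hk
  exact ⟨x + y, D.add_mem hx hy, (AEEqFun.coeFn_add _ _).trans (ex.add ey)⟩

theorem const_mul (c : ℝ) (hh : Represents D h) : Represents D fun ω => c * h ω := by
  obtain ⟨x, hx, ex⟩ := hh
  exact ⟨c • x, D.smul_mem c hx, (AEEqFun.coeFn_smul _ _).trans (ex.const_smul c)⟩

theorem sub (hh : Represents D h) (hk : Represents D k) : Represents D fun ω => h ω - k ω := by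
  simpa [sub_eq_add_neg] using hh.add (hk.const_mul (-1))

theorem sum {h : ℕ → Ω → ℝ} (hh : ∀ n, Represents D (h n)) (n : ℕ) :
    Represents D fun ω => ∑ i ∈ Finset.range n, h i ω := by
  induction n with
  | zero => simpa using zero D
  | succ n ih => simpa only [Finset.sum_range_succ] using ih.add (hh n)

theorem mem {x : X} (hx : Represents D (x : L0 P)) : x ∈ D := by
  obtain ⟨y, hy, e⟩ := hx
  rwa [← show y = x from Subtype.ext (AEEqFun.ext e)]

theorem of_tendsto (hX : IsIdeal X) (hD : IsDominatedClosed D) {u : ℕ → Ω → ℝ} {y : X}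
    (hu : ∀ n, Represents D (u n)) (huy : ∀ n, ∀ᵐ ω ∂P, |u n ω| ≤ (y : L0 P) ω)
    (hlim : ∀ᵐ ω ∂P, Tendsto (fun n => u n ω) atTop (𝓝 (h ω))) : Represents D h := by
  choose x hxD hx using hu
  have hxa := ae_all_iff.2 hx
  have hm : AEMeasurable h P := aemeasurable_of_tendsto_metrizable_ae atTop
    (fun n => (x n : L0 P).measurable.aemeasurable.congr (hx n)) hlim
  have e := AEEqFun.coeFn_mk h hm.aestronglyMeasurable
  have hvX : AEEqFun.mk h hm.aestronglyMeasurable ∈ X := by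
    refine hX.mem_of_ae_abs_le y.2 ?_
    filter_upwards [e, ae_all_iff.2 huy, hlim] with ω h1 h2 h3
    rw [h1]
    exact (le_of_tendsto' h3.abs h2).trans (le_abs_self _)
  refine ⟨⟨_, hvX⟩, hD x _ y hxD (fun n => ?_) ?_, e⟩
  · filter_upwards [hx n, huy n] with ω h1 h2
    rwa [h1]
  · filter_upwards [hxa, hlim, e] with ω h1 h2 h3
    simp only [h1, h3]
    exact h2

end Represents

/-! ### From call payoffs to all `σ(f)`-measurable elements -/

theorem abs_slope_le_one (n : ℕ) (s : ℝ) :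
    |((n : ℝ) + 1) * (max s 0 - max (s - 1 / ((n : ℝ) + 1)) 0)| ≤ 1 := by
  have hn : (0 : ℝ) < (n : ℝ) + 1 := by positivity
  have h1 : |max s 0 - max (s - 1 / ((n : ℝ) + 1)) 0| ≤ 1 / ((n : ℝ) + 1) := by
    refine (abs_max_sub_max_le_abs _ _ _).trans_eq ?_
    rw [sub_sub_cancel, abs_of_pos (by positivity)]
  rw [abs_mul, abs_of_pos hn]
  calc _ ≤ ((n : ℝ) + 1) * (1 / ((n : ℝ) + 1)) := by gcongr
    _ = 1 := mul_one_div_cancel hn.ne'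

/-- These are left difference quotients of `s ↦ s⁺`. The left derivative at `0` is `0`, which is why
the open half-line appears. -/
theorem tendsto_slope (s : ℝ) :
    Tendsto (fun n : ℕ => ((n : ℝ) + 1) * (max s 0 - max (s - 1 / ((n : ℝ) + 1)) 0)) atTop
      (𝓝 ((Set.Ioi 0).indicator (fun _ => (1 : ℝ)) s)) := by
  rcases le_or_gt s 0 with hs | hs
  · rw [Set.indicator_of_notMem (by simpa using hs)]
    refine tendsto_const_nhds.congr fun n => ?_
    have hn : (0 : ℝ) < 1 / ((n : ℝ) + 1) := by positivity
    rw [max_eq_right hs, max_eq_right (by linarith)]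
    simp
  · rw [Set.indicator_of_mem (by simpa using hs)]
    refine tendsto_const_nhds.congr' ?_
    filter_upwards [tendsto_one_div_add_atTop_nhds_zero_nat.eventually (gt_mem_nhds hs)] with n hn
    have hn' : (n : ℝ) + 1 ≠ 0 := by positivity
    rw [max_eq_left hs.le, max_eq_left (by linarith), sub_sub_cancel, mul_one_div_cancel hn']

section

variable {X : Submodule ℝ (L0 P)} {D : Submodule ℝ X}

theorem represents_max_sub (hX : IsIdeal X) (hconst : ∀ c : ℝ, AEEqFun.const Ω c ∈ X) {f : X}
    (hfD : ∀ x : X, (x : L0 P) ∈ optionSpace (f : L0 P) → x ∈ D) (k : ℝ) :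
    Represents D fun ω => max ((f : L0 P) ω - k) 0 := by
  have hmem : ((f : L0 P) - AEEqFun.const Ω k)⁺ ∈ X := by
    refine hX.mem_of_ae_abs_le (X.sub_mem f.2 (hconst k)) ?_
    filter_upwards [coeFn_posPart_sub_const (f : L0 P) k,
      AEEqFun.coeFn_sub (f : L0 P) (AEEqFun.const Ω k), AEEqFun.coeFn_const Ω (μ := P) k]
      with ω h1 h2 h3
    rw [h1, h2, Pi.sub_apply, h3, Function.const_apply, abs_of_nonneg (le_max_right _ _)]
    exact max_le (le_abs_self _) (abs_nonneg _)
  exact ⟨⟨_, hmem⟩, hfD _ (Submodule.subset_span (Or.inr ⟨k, rfl⟩)),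
    coeFn_posPart_sub_const (f : L0 P) k⟩

theorem represents_const_one (hconst : ∀ c : ℝ, AEEqFun.const Ω c ∈ X) {f : X}
    (hfD : ∀ x : X, (x : L0 P) ∈ optionSpace (f : L0 P) → x ∈ D) :
    Represents D fun _ => 1 :=
  ⟨⟨_, hconst 1⟩, hfD _ (Submodule.subset_span (Or.inl rfl)), AEEqFun.coeFn_one⟩

/-- Induction from the π-system of half-lines `Ioi k`, which are reached by the slopes above; the
constant `1` dominates every limit that is taken. -/
theorem represents_indicator_preimage (hX : IsIdeal X)
    (hconst : ∀ c : ℝ, AEEqFun.const Ω c ∈ X) {f : X} (hD : IsDominatedClosed D)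
    (hfD : ∀ x : X, (x : L0 P) ∈ optionSpace (f : L0 P) → x ∈ D) {B : Set ℝ}
    (hB : MeasurableSet B) :
    Represents D fun ω => B.indicator (fun _ => (1 : ℝ)) ((f : L0 P) ω) := by
  have hone : ∀ᵐ ω ∂P, ((⟨_, hconst 1⟩ : X) : L0 P) ω = 1 := AEEqFun.coeFn_const Ω 1
  induction B, hB using MeasurableSpace.induction_on_inter
    ((BorelSpace.measurable_eq (α := ℝ)).trans (borel_eq_generateFrom_Ioi ℝ)) isPiSystem_Ioi with
  | empty => simpa using Represents.zero D
  | basic t ht =>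
    obtain ⟨k, rfl⟩ := ht
    refine Represents.of_tendsto hX hD (y := ⟨_, hconst 1⟩) (u := fun n ω =>
      ((n : ℝ) + 1) * (max ((f : L0 P) ω - k) 0 - max ((f : L0 P) ω - k - 1 / ((n : ℝ) + 1)) 0))
      (fun n => ?_) (fun n => ?_) (.of_forall fun ω => ?_)
    · simp only [sub_sub]
      exact ((represents_max_sub hX hconst hfD k).sub
        (represents_max_sub hX hconst hfD _)).const_mul _
    · filter_upwards [hone] with ω h
      rw [h]
      exact abs_slope_le_one _ _
    · have := tendsto_slope ((f : L0 P) ω - k)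
      simpa only [Set.indicator, Set.mem_Ioi, sub_pos] using this
  | compl t _ ih =>
    refine ((represents_const_one hconst hfD).sub ih).congr (.of_forall fun ω => ?_)
    by_cases h : (f : L0 P) ω ∈ t <;> simp [h]
  | iUnion t hdisj _ ih =>
    have hsum : ∀ n s, ∑ i ∈ Finset.range n, (t i).indicator (fun _ => (1 : ℝ)) s =
        (⋃ i ∈ Finset.range n, t i).indicator (fun _ => 1) s := fun n s =>
      (Finset.indicator_biUnion_apply _ _ (fun i _ j _ hij => hdisj hij) s).symm
    refine Represents.of_tendsto hX hD (y := ⟨_, hconst 1⟩) (Represents.sum ih) (fun n => ?_)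
      (.of_forall fun ω => ?_)
    · filter_upwards [hone] with ω h
      rw [h, hsum, abs_of_nonneg (Set.indicator_nonneg (fun _ _ => zero_le_one) _)]
      exact Set.indicator_le_self' (fun _ _ => zero_le_one) _
    · simp only [hsum]
      by_cases h : (f : L0 P) ω ∈ ⋃ i, t i
      · obtain ⟨i, hi⟩ := Set.mem_iUnion.1 h
        rw [Set.indicator_of_mem h]
        refine tendsto_const_nhds.congr' ?_
        filter_upwards [eventually_gt_atTop i] with n hn
        rw [Set.indicator_of_mem]
        exact Set.mem_biUnion (by simpa using hn) hi
      · rw [Set.indicator_of_notMem h]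
        refine tendsto_const_nhds.congr fun n => ?_
        rw [Set.indicator_of_notMem]
        exact fun h' => h (Set.iUnion₂_subset_iUnion _ _ h')

theorem represents_simpleFunc {f : L0 P}
    (hm : ∀ A, MeasurableSet[sigmaAlgebraOf f] A → Represents D (A.indicator fun _ => 1))
    (s : @SimpleFunc Ω (sigmaAlgebraOf f) ℝ) : Represents D s := by
  refine @SimpleFunc.induction Ω ℝ (sigmaAlgebraOf f) _ (fun s => Represents D s) (fun c A hA => ?_)
    (fun _ _ _ h1 h2 => h1.add h2) s
  refine ((hm A hA).const_mul c).congr (.of_forall fun ω => ?_)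
  by_cases h : ω ∈ A <;> simp [h]

theorem mem_of_measurable_sigmaAlgebraOf (hX : IsIdeal X)
    (hconst : ∀ c : ℝ, AEEqFun.const Ω c ∈ X) {f : X} (hD : IsDominatedClosed D)
    (hfD : ∀ x : X, (x : L0 P) ∈ optionSpace (f : L0 P) → x ∈ D) {g : X}
    (hg : Measurable[sigmaAlgebraOf (f : L0 P)] (g : L0 P)) : g ∈ D := by
  have hm : ∀ A, MeasurableSet[sigmaAlgebraOf (f : L0 P)] A →
      Represents D (A.indicator fun _ => 1) := fun A hA => by
    obtain ⟨B, hB, hAB⟩ := exists_measurableSet_ae_eq_preimage _ hA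
    refine (represents_indicator_preimage hX hconst hD hfD hB).congr ?_
    filter_upwards [hAB.mem_iff] with ω h
    by_cases hω : ω ∈ A
    · rw [Set.indicator_of_mem hω, Set.indicator_of_mem (s := B) (h.1 hω)]
    · rw [Set.indicator_of_notMem hω, Set.indicator_of_notMem (s := B) fun hB => hω (h.2 hB)]
  -- The approximation `approxOn` based at `0` is bounded by `‖g‖ + ‖g‖`, whence the dominating
  -- element `2 |g|` of `X`.
  refine Represents.mem (Represents.of_tendsto hX hD
    (y := (2 : ℝ) • ⟨_, hX.abs_mem g.2⟩)
    (u := fun n => @SimpleFunc.approxOn ℝ Ω _ _ _ (sigmaAlgebraOf (f : L0 P)) _ hg Set.univ 0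
      (Set.mem_univ 0) _ n)
    (fun n => represents_simpleFunc hm _) (fun n => ?_) (.of_forall fun ω => ?_))
  · filter_upwards [AEEqFun.coeFn_abs (g : L0 P), AEEqFun.coeFn_smul (2 : ℝ) |(g : L0 P)|]
      with ω h1 h2
    refine (@SimpleFunc.norm_approxOn_zero_le Ω ℝ (sigmaAlgebraOf (f : L0 P)) _ _ _ _ hg Set.univ
      (Set.mem_univ 0) _ ω n).trans_eq ?_
    refine Eq.trans ?_ h2.symm
    rw [Pi.smul_apply, h1, Real.norm_eq_abs, smul_eq_mul, two_mul]
  · exact @SimpleFunc.tendsto_approxOn ℝ Ω _ _ _ (sigmaAlgebraOf (f : L0 P)) _ hg Set.univ 0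
      (Set.mem_univ 0) _ ω (by simp)

/-! ### The weak closure under dominated limits -/

/-- The weak closure of a subspace of `X`. -/
def weakClosure (S : Submodule ℝ X) : Submodule ℝ X :=
  letI := sigmaTopology X
  haveI : ContinuousAdd X := WeakBilin.instContinuousAdd (orderContinuousDual X).subtype.flip
  haveI : ContinuousSMul ℝ X := WeakBilin.instContinuousSMul (orderContinuousDual X).subtype.flip
  S.topologicalClosure

theorem mem_weakClosure {S : Submodule ℝ X} {x : X} :
    x ∈ weakClosure S ↔ x ∈ closure[sigmaTopology X] (S : Set X) :=
  Iff.rfl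

theorem tendsto_sigmaTopology {x : ℕ → X} {a : X}
    (h : ∀ φ ∈ orderContinuousDual X, Tendsto (fun n => φ (x n)) atTop (𝓝 (φ a))) :
    Tendsto x atTop (@nhds X (sigmaTopology X) a) := by
  have e : @nhds X (sigmaTopology X) a =
      comap (fun (x : X) (φ : orderContinuousDual X) => (φ : X →ₗ[ℝ] ℝ) x)
        (𝓝 fun φ => (φ : X →ₗ[ℝ] ℝ) a) := nhds_induced _ _
  rw [e, tendsto_comap_iff, tendsto_pi_nhds]
  exact fun φ => h φ φ.2

/-- Dominated a.e. convergence implies convergence under every order continuous functional, that is,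
weak convergence. -/
theorem isDominatedClosed_weakClosure (hX : IsIdeal X) (S : Submodule ℝ X) :
    IsDominatedClosed (weakClosure S) := by
  intro u v y hu huy hlim
  let _ := sigmaTopology X
  have hc : IsClosed (weakClosure S : Set X) := isClosed_closure
  exact hc.mem_of_tendsto
    (tendsto_sigmaTopology fun φ hφ => tendsto_of_dominated hX hφ huy hlim)
    (.of_forall hu)

end

end OptionSpan

theorem theorem3p1 {Ω : Type*} [MeasurableSpace Ω] (P : Measure Ω) [IsProbabilityMeasure P]
    (X : Submodule ℝ (L0 P)) (hX : OptionSpan.IsIdeal X)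
    (hconst : ∀ c : ℝ, AEEqFun.const Ω c ∈ X)
    (hpos : ∃ φ ∈ OptionSpan.orderContinuousDual X, OptionSpan.IsStrictlyPositive X φ)
    (f : X) (hf : 0 ≤ f) (g : X) :
    List.TFAE [
      Measurable[OptionSpan.sigmaAlgebraOf (f : L0 P)] ((g : L0 P) : Ω → ℝ),
      g ∈ closure[OptionSpan.sigmaTopology X]
        {h : X | (h : L0 P) ∈ OptionSpan.optionSpace (f : L0 P)},
      ∃ u : ℕ → L0 P, (∀ n, u n ∈ OptionSpan.optionSpace (f : L0 P)) ∧
        ∀ᵐ ω ∂P, Tendsto (fun n => (u n : Ω → ℝ) ω) atTop (𝓝 ((g : L0 P) ω))] := by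
  obtain ⟨φ, hφ, hφpos⟩ := hpos
  tfae_have 1 → 2 := fun h =>
    OptionSpan.mem_of_measurable_sigmaAlgebraOf hX hconst
      (OptionSpan.isDominatedClosed_weakClosure hX
        ((OptionSpan.optionSpace (f : L0 P)).comap X.subtype))
      (fun _ hx => OptionSpan.mem_weakClosure.2
        (@subset_closure _ (OptionSpan.sigmaTopology X) _ _ hx)) h
  tfae_have 2 → 3 := fun h => by
    obtain ⟨u, hu, hlim⟩ := OptionSpan.exists_seq_ae_tendsto_of_mem_closure hX hconst hφ hφpos
      ((OptionSpan.optionSpace (f : L0 P)).comap X.subtype) h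
    exact ⟨fun n => u n, hu, hlim⟩
  tfae_have 3 → 1 := fun ⟨_, hu, hlim⟩ =>
    OptionSpan.measurable_sigmaAlgebraOf_of_tendsto _
      (fun n => OptionSpan.measurable_of_mem_optionSpace _ (hu n)) (AEEqFun.measurable _) hlim
  tfae_finish
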